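/- Theorem 4 (Paley–Wiener). Let $c\in\mathbb{R}$ and $T>0$, and write $\mathbb{R}^+=(0,\infty)$ and $\mathbb{H}=\mathbb{R}^+\times\mathbb{R}$. Let $X^2_c$ be the space of functions $\varphi:\mathbb{R}^+\to\mathbb{C}$ such that $u\mapsto \varphi(u)\,u^{c-1/2}$ belongs to $L^2(\mathbb{R}^+)$. For $\varphi\in X^2_c$ let $M^2_c[\varphi]$ be its $L^2$-Mellin transform on the line $c+i\mathbb{R}$, that is, $t\mapsto M^2_c[\varphi](c+it)$ is the limit in $L^2(\mathbb{R})$, as $\rho\to\infty$, of $t\mapsto\int_{1/\rho}^{\rho}\varphi(u)\,u^{c+it-1}\,du$. The Paley–Wiener space $B^2_{c,T}$ consists of all continuous $\varphi\in X^2_c$ such that $M^2_c[\varphi](c+it)=0$ for almost all $t\in\mathbb{R}$ with $|t|>T$. The Mellin–Bernstein space $\mathscr{B}^2_{c,T}$ consists of all functions $f:\mathbb{H}\to\mathbb{C}$ such that (i) $f$ is polar-analytic on $\mathbb{H}$: for every $(r_0,\theta_0)\in\mathbb{H}$ the limit $$\lim_{(r,\theta)\to(r_0,\theta_0)}\frac{f(r,\theta)-f(r_0,\theta_0)}{re^{i\theta}-r_0e^{i\theta_0}}$$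 exists in $\mathbb{C}$, with $(r,\theta)$ ranging over $\mathbb{H}\setminus\{(r_0,\theta_0)\}$; (ii) $f(\cdot,0)\in X^2_c$; (iii) there is a constant $C_f>0$ such that $|f(r,\theta)|\le C_f\,r^{-c}e^{T|\theta|}$ for all $(r,\theta)\in\mathbb{H}$. Then a function $\varphi\in X^2_c$ belongs to $B^2_{c,T}$ if and only if there exists $f\in\mathscr{B}^2_{c,T}$ with $f(r,0)=\varphi(r)$ for all $r>0$. -/

import Mathlib

open MeasureTheory Filter Topology

noncomputable section

/-- The space `X^p_c` (for `1 ≤ p < ∞`) of functions on `ℝ⁺ = (0, ∞)`: those `φ` for which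
`u ↦ φ(u) u^(c - 1/p)` belongs to `L^p(ℝ⁺)`. Values of `φ` outside `(0, ∞)` play no role. -/
def MellinX (p c : ℝ) : Set (ℝ → ℂ) :=
  {φ | MemLp (fun u : ℝ => φ u * ((u ^ (c - 1 / p) : ℝ) : ℂ)) (ENNReal.ofReal p)
    (volume.restrict (Set.Ioi (0 : ℝ)))}

/-- The truncated Mellin integral `∫_{1/ρ}^{ρ} φ(u) u^(s-1) du` at `s = c + it`. -/
def truncatedMellin (c : ℝ) (φ : ℝ → ℂ) (ρ t : ℝ) : ℂ :=
  ∫ u in Set.Icc (1 / ρ) ρ, φ u * (u : ℂ) ^ (((c : ℂ) + (t : ℂ) * Complex.I) - 1)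

/-- `g` is (a version of) the function `t ↦ M_c^2[φ](c + it)`, the `L^2`-Mellin transform of `φ`
on the line `c + iℝ`: it is in `L^2(ℝ)` and it is the limit in `L^2(ℝ)` of the truncated Mellin
integrals as `ρ → ∞`. -/
def IsMellinTransformL2 (c : ℝ) (φ : ℝ → ℂ) (g : ℝ → ℂ) : Prop :=
  MemLp g 2 volume ∧
    Tendsto (fun ρ : ℝ => eLpNorm (fun t : ℝ => g t - truncatedMellin c φ ρ t) 2 volume)
      atTop (𝓝 0)

/-- A function in `X^2_c` is a.e. strongly measurable on every `[1/ρ, ρ]`, `ρ > 0`. -/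
theorem MellinX.aestronglyMeasurable {c : ℝ} {φ : ℝ → ℂ} (hφ : φ ∈ MellinX 2 c) {ρ : ℝ}
    (hρ : 0 < ρ) : AEStronglyMeasurable φ (volume.restrict (Set.Icc (1 / ρ) ρ)) := by
  have hsub : Set.Icc (1 / ρ) ρ ⊆ Set.Ioi (0 : ℝ) := fun x hx =>
    lt_of_lt_of_le (by positivity) hx.1
  have h1 := (hφ.1).mono_measure (Measure.restrict_mono hsub le_rfl)
  have h2 : AEStronglyMeasurable (fun u : ℝ => ((u ^ (-(c - 1 / 2)) : ℝ) : ℂ))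
      (volume.restrict (Set.Icc (1 / ρ) ρ)) := by
    apply Measurable.aestronglyMeasurable
    fun_prop
  refine (h1.mul h2).congr ?_
  filter_upwards [ae_restrict_mem measurableSet_Icc] with u hu
  have hu0 : (0 : ℝ) < u := hsub hu
  simp only [Pi.mul_apply]
  rw [mul_assoc, ← Complex.ofReal_mul, ← Real.rpow_add hu0]
  simp

/-- The `L^2`-Mellin transform is unique up to a null set. -/
theorem IsMellinTransformL2.ae_eq {c : ℝ} {φ g₁ g₂ : ℝ → ℂ} (hφ : φ ∈ MellinX 2 c)
    (h₁ : IsMellinTransformL2 c φ g₁) (h₂ : IsMellinTransformL2 c φ g₂) :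
    g₁ =ᵐ[volume] g₂ := by
  have hF : ∀ ρ : ℝ, 0 < ρ → AEStronglyMeasurable (truncatedMellin c φ ρ) volume := by
    intro ρ hρ
    have hm := MellinX.aestronglyMeasurable hφ hρ
    have : AEStronglyMeasurable (fun z : ℝ × ℝ =>
        φ z.2 * (z.2 : ℂ) ^ (((c : ℂ) + (z.1 : ℂ) * Complex.I) - 1))
        ((volume : Measure ℝ).prod (volume.restrict (Set.Icc (1 / ρ) ρ))) := by
      refine (hm.comp_snd).mul (Measurable.aestronglyMeasurable ?_)
      fun_prop
    exact this.integral_prod_right'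
  have hle : ∀ ρ : ℝ, 0 < ρ → eLpNorm (g₁ - g₂) 2 volume ≤
      eLpNorm (fun t : ℝ => g₁ t - truncatedMellin c φ ρ t) 2 volume +
      eLpNorm (fun t : ℝ => g₂ t - truncatedMellin c φ ρ t) 2 volume := by
    intro ρ hρ
    have h := eLpNorm_sub_le (p := 2) (μ := volume) (h₁.1.1.sub (hF ρ hρ))
      (h₂.1.1.sub (hF ρ hρ)) (by norm_num)
    rw [sub_sub_sub_cancel_right] at h
    exact h
  have hlim := h₁.2.add h₂.2
  rw [add_zero] at hlim
  have h0 : eLpNorm (g₁ - g₂) 2 volume ≤ 0 :=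
    ge_of_tendsto hlim ((eventually_gt_atTop 0).mono hle)
  have h3 := (eLpNorm_eq_zero_iff (h₁.1.1.sub h₂.1.1) (by norm_num)).1 (le_antisymm h0 bot_le)
  filter_upwards [h3] with t ht
  exact sub_eq_zero.1 ht

/-- The Mellin Paley–Wiener space `B^2_{c,T}`: continuous functions in `X^2_c` whose
`L^2`-Mellin transform vanishes at `c + it` for almost all `t` with `|t| > T`. The transform is
unique up to null sets, so it does not matter which version of it is tested. -/
def MellinPaleyWiener (c T : ℝ) : Set (ℝ → ℂ) :=
  {φ | φ ∈ MellinX 2 c ∧ ContinuousOn φ (Set.Ioi (0 : ℝ)) ∧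
    ∃ g : ℝ → ℂ, IsMellinTransformL2 c φ g ∧ ∀ᵐ t : ℝ, T < |t| → g t = 0}

/-- The polar plane `ℍ = ℝ⁺ × ℝ`, consisting of the pairs `(r, θ)` with `r > 0`. -/
def polarPlane : Set (ℝ × ℝ) := {z | 0 < z.1}

/-- The point `r e^{iθ}` of the complex plane. -/
def polarPoint (z : ℝ × ℝ) : ℂ := (z.1 : ℂ) * Complex.exp ((z.2 : ℂ) * Complex.I)

/-- `f` is polar-analytic on `D ⊆ ℍ`: at each `(r₀, θ₀) ∈ D` the quotients
`(f(r, θ) - f(r₀, θ₀)) / (r e^{iθ} - r₀ e^{iθ₀})` have a limit as `(r, θ) → (r₀, θ₀)` in `D`,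
`(r, θ) ≠ (r₀, θ₀)`. -/
def PolarAnalyticOn (f : ℝ × ℝ → ℂ) (D : Set (ℝ × ℝ)) : Prop :=
  ∀ z₀ ∈ D, ∃ d : ℂ,
    Tendsto (fun z : ℝ × ℝ => (f z - f z₀) / (polarPoint z - polarPoint z₀))
      (𝓝[D \ {z₀}] z₀) (𝓝 d)

/-- The Mellin–Bernstein space `𝓑^p_{c,T}` (for `1 ≤ p < ∞`). Values of `f` outside `ℍ` play no
role. -/
def MellinBernstein (p c T : ℝ) : Set (ℝ × ℝ → ℂ) :=
  {f | PolarAnalyticOn f polarPlane ∧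
    (fun r : ℝ => f (r, 0)) ∈ MellinX p c ∧
    ∃ C : ℝ, 0 < C ∧ ∀ r θ : ℝ, 0 < r →
      ‖f (r, θ)‖ ≤ C * r ^ (-c) * Real.exp (T * |θ|)}

end

/-! The substitution u = e^{-2πs} turns the Mellin kernel on c + iℝ into the Fourier kernel
e^{-2πist}, so the L²-Mellin transform of φ is the L²-Fourier transform of ψ(s) = 2π e^{-2πcs}
φ(e^{-2πs}) (`isMellinTransformL2_fourier`). The substitution w = log r + iθ identifies
polar-analytic functions on ℍ with entire functions of w. Since s corresponds to -w/(2π), the bound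
C r^{-c} e^{T|θ|} says that the entire extension of ψ is O(e^{2πT|Im z|}). The theorem thus becomes
the classical Paley–Wiener theorem for ψ.

If the transform g of ψ lives on [-T, T], it is integrable there. Fourier inversion and continuity
give ψ = 𝓕⁻g everywhere, and the integral defining 𝓕⁻g converges for complex arguments with the
required growth.

Conversely, let h be an entire extension of ψ with that growth. Dividing by (1 + iεz)² makes it
integrable on ℝ and puts the only pole in the upper half plane. For t > T the line of integration in
the Fourier integral can be pushed to -i∞, so the integral vanishes
(`fourier_div_one_add_I_mul_sq_eq_zero`). Letting ε → 0 in L² and using Plancherel gives the claim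
for t > T; reflection gives t < -T. -/

/-! ### L²-Fourier transform versus Fourier integrals -/

open scoped FourierTransform ENNReal in
/-- On `L¹ ∩ L²` the `L²`-Fourier transform is given by the Fourier integral. -/
theorem fourier_toLp_ae_eq {f : ℝ → ℂ} (h1 : Integrable f) (h2 : MemLp f 2 volume) :
    (𝓕 (h2.toLp f) : Lp ℂ 2 (volume : Measure ℝ)) =ᵐ[volume] 𝓕 f := by
  have hcont : Continuous (𝓕 f) := VectorFourier.fourierIntegral_continuous
    Real.continuous_fourierChar (innerSL ℝ).continuous₂ h1
  refine ae_eq_of_integral_contDiff_smul_eq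
    ((Lp.memLp _).locallyIntegrable (by norm_num)) hcont.locallyIntegrable fun g hg hgs => ?_
  -- Against a test function, the L² transform moves onto η by the definition of the distributional
  -- transform, the Fourier integral by Fubini; the two pairings agree.
  let η : SchwartzMap ℝ ℂ := (hgs.comp_left (g := ((↑) : ℝ → ℂ)) rfl).toSchwartzMap
    (Complex.ofRealCLM.contDiff.comp hg)
  have hη : ∀ x, η x = (g x : ℂ) := fun x => rfl
  have e1 := Lp.toTemperedDistribution_apply (𝓕 (h2.toLp f)) η
  rw [← Lp.fourier_toTemperedDistribution_eq, TemperedDistribution.fourier_apply,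
    Lp.toTemperedDistribution_apply] at e1
  have e2 : ∫ x, (𝓕 η) x • h2.toLp f x = ∫ x, (𝓕 (η : ℝ → ℂ)) x • f x := by
    refine integral_congr_ae ?_
    filter_upwards [h2.coeFn_toLp] with x hx
    rw [hx, SchwartzMap.fourier_coe]
  have e3 : ∫ x, (𝓕 (η : ℝ → ℂ)) x • f x = ∫ x, η x • 𝓕 f x := by
    simpa using! VectorFourier.integral_fourierIntegral_smul_eq_flip (L := innerₗ ℝ)
      Real.continuous_fourierChar continuous_inner η.integrable h1
  rw [e2, e3] at e1
  simp only [hη] at e1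
  simpa using e1.symm

open scoped FourierTransform ENNReal in
/-- On `L¹ ∩ L²` the inverse `L²`-Fourier transform is given by the inverse Fourier integral. -/
theorem fourierInv_toLp_ae_eq {f : ℝ → ℂ} (h1 : Integrable f) (h2 : MemLp f 2 volume) :
    (𝓕⁻ (h2.toLp f) : Lp ℂ 2 (volume : Measure ℝ)) =ᵐ[volume] 𝓕⁻ f := by
  have hcont : Continuous (𝓕⁻ f) := VectorFourier.fourierIntegral_continuous
    Real.continuous_fourierChar (L := -innerₗ ℝ) (by exact continuous_inner.neg) h1
  refine ae_eq_of_integral_contDiff_smul_eq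
    ((Lp.memLp _).locallyIntegrable (by norm_num)) hcont.locallyIntegrable fun g hg hgs => ?_
  let η : SchwartzMap ℝ ℂ := (hgs.comp_left (g := ((↑) : ℝ → ℂ)) rfl).toSchwartzMap
    (Complex.ofRealCLM.contDiff.comp hg)
  have hη : ∀ x, η x = (g x : ℂ) := fun x => rfl
  have e1 := Lp.toTemperedDistribution_apply (𝓕⁻ (h2.toLp f)) η
  rw [← Lp.fourierInv_toTemperedDistribution_eq, TemperedDistribution.fourierInv_apply,
    Lp.toTemperedDistribution_apply] at e1
  have e2 : ∫ x, (𝓕⁻ η) x • h2.toLp f x = ∫ x, (𝓕⁻ (η : ℝ → ℂ)) x • f x := by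
    refine integral_congr_ae ?_
    filter_upwards [h2.coeFn_toLp] with x hx
    rw [hx, SchwartzMap.fourierInv_coe]
  have e3 : ∫ x, (𝓕⁻ (η : ℝ → ℂ)) x • f x = ∫ x, η x • 𝓕⁻ f x := by
    have hfl : (-innerₗ ℝ : ℝ →ₗ[ℝ] ℝ →ₗ[ℝ] ℝ).flip = -innerₗ ℝ := by
      ext; simp
    have := VectorFourier.integral_fourierIntegral_smul_eq_flip (μ := volume) (ν := volume)
      (L := -innerₗ ℝ)
      Real.continuous_fourierChar (by exact continuous_inner.neg) η.integrable h1
    rwa [hfl] at this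
  rw [e2, e3] at e1
  simp only [hη] at e1
  simpa using e1.symm

open scoped FourierTransform ENNReal in
/-- Plancherel estimate comparing an `L²`-Fourier transform with a Fourier integral. -/
theorem eLpNorm_fourier_sub {ψ f : ℝ → ℂ} (hψ : MemLp ψ 2 volume) (h1 : Integrable f)
    (h2 : MemLp f 2 volume) :
    eLpNorm (fun t => (𝓕 (hψ.toLp ψ) : Lp ℂ 2 (volume : Measure ℝ)) t - 𝓕 f t) 2 volume =
      eLpNorm (fun s => ψ s - f s) 2 volume := by
  have e1 : eLpNorm (fun t => (𝓕 (hψ.toLp ψ) : Lp ℂ 2 (volume : Measure ℝ)) t - 𝓕 f t) 2 volume =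
      eLpNorm (𝓕 (hψ.toLp ψ - h2.toLp f) : Lp ℂ 2 (volume : Measure ℝ)) 2 volume := by
    refine eLpNorm_congr_ae ?_
    have : (𝓕 (hψ.toLp ψ - h2.toLp f) : Lp ℂ 2 (volume : Measure ℝ)) =
        𝓕 (hψ.toLp ψ) - 𝓕 (h2.toLp f) := (Lp.fourierTransformₗᵢ ℝ ℂ).map_sub _ _
    rw [this]
    filter_upwards [Lp.coeFn_sub (𝓕 (hψ.toLp ψ)) (𝓕 (h2.toLp f)), fourier_toLp_ae_eq h1 h2]
      with t h3 h4
    rw [h3, Pi.sub_apply, h4]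
  rw [e1, ← Lp.enorm_def, ← ofReal_norm, Lp.norm_fourier_eq, ofReal_norm, ← MemLp.toLp_sub,
    Lp.enorm_def]
  exact eLpNorm_congr_ae (MemLp.coeFn_toLp _)

open scoped FourierTransform ENNReal in
/-- A square integrable function with integrable `L²`-Fourier transform `g` is the inverse Fourier
integral of `g`. -/
theorem ae_eq_fourierInv_of_fourier {ψ g : ℝ → ℂ} (hψ : MemLp ψ 2 volume) (h1 : Integrable g)
    (h : (𝓕 (hψ.toLp ψ) : Lp ℂ 2 (volume : Measure ℝ)) =ᵐ[volume] g) : ψ =ᵐ[volume] 𝓕⁻ g := by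
  have h2 : MemLp g 2 volume := (memLp_congr_ae h).1 (Lp.memLp _)
  have e : h2.toLp g = 𝓕 (hψ.toLp ψ) := Lp.ext (h2.coeFn_toLp.trans h.symm)
  have h3 := fourierInv_toLp_ae_eq h1 h2
  rw [e, FourierTransform.fourierInv_fourier_eq] at h3
  exact hψ.coeFn_toLp.symm.trans h3

open scoped ENNReal in
/-- Dominated convergence in `L²`. -/
theorem tendsto_eLpNorm_two_sub_of_dominated {ι : Type*} {l : Filter ι} [l.IsCountablyGenerated]
    {ψ : ℝ → ℂ} {f : ι → ℝ → ℂ} (hψ : MemLp ψ 2 volume)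
    (hf : ∀ᶠ n in l, AEStronglyMeasurable (f n) volume)
    (hb : ∀ᶠ n in l, ∀ s, ‖f n s‖ ≤ ‖ψ s‖)
    (hlim : ∀ s, Tendsto (fun n => f n s) l (𝓝 (ψ s))) :
    Tendsto (fun n => eLpNorm (fun s => ψ s - f n s) 2 volume) l (𝓝 0) := by
  have key : Tendsto (fun n => ∫⁻ s, ‖ψ s - f n s‖ₑ ^ (2 : ℝ)) l (𝓝 (∫⁻ _ : ℝ, 0)) := by
    refine tendsto_lintegral_filter_of_dominated_convergence'
      (fun s => ‖(2 : ℂ) • ψ s‖ₑ ^ (2 : ℝ)) ?_ ?_ ?_ ?_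
    · filter_upwards [hf] with n hn
      exact (hψ.1.sub hn).enorm.pow_const _
    · filter_upwards [hb] with n hn
      refine Eventually.of_forall fun s => ?_
      refine ENNReal.rpow_le_rpow (enorm_le_iff_norm_le.2 ?_) (by norm_num)
      calc ‖ψ s - f n s‖ ≤ ‖ψ s‖ + ‖f n s‖ := norm_sub_le _ _
        _ ≤ ‖(2 : ℂ) • ψ s‖ := by rw [norm_smul]; norm_num; linarith [hn s]
    · have h2 := (hψ.const_smul (2 : ℂ)).eLpNorm_lt_top
      have := eLpNorm_nnreal_pow_eq_lintegral (μ := volume) (f := fun s => (2 : ℂ) • ψ s)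
        (p := 2) (by norm_num)
      simp only [NNReal.coe_ofNat, ENNReal.coe_ofNat] at this
      rw [← this]
      exact (ENNReal.rpow_lt_top_of_nonneg (by norm_num) h2.ne).ne
    · refine Eventually.of_forall fun s => ?_
      have h1 : Tendsto (fun n => ‖ψ s - f n s‖ₑ ^ (2 : ℝ)) l (𝓝 (‖ψ s - ψ s‖ₑ ^ (2 : ℝ))) :=
        (ENNReal.continuous_rpow_const.tendsto _).comp
          ((continuous_enorm.tendsto _).comp (tendsto_const_nhds.sub (hlim s)))
      simpa using h1
  have h3 := (ENNReal.continuous_rpow_const (y := 1 / 2)).tendsto _ |>.comp key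
  simp only [lintegral_zero] at h3
  rw [ENNReal.zero_rpow_of_pos (by norm_num)] at h3
  refine h3.congr fun n => ?_
  have := eLpNorm_nnreal_pow_eq_lintegral (μ := volume) (f := fun s => ψ s - f n s)
    (p := 2) (by norm_num)
  simp only [NNReal.coe_ofNat, ENNReal.coe_ofNat] at this
  simp only [Function.comp_apply]
  rw [← this, ← ENNReal.rpow_mul]
  norm_num

/-! ### The substitution u = e^{-2πs} -/

/-- The function on `ℝ` whose Fourier transform is the Mellin transform of `φ` on the line
`c + iℝ`. -/
noncomputable def mellinPullback (c : ℝ) (φ : ℝ → ℂ) (s : ℝ) : ℂ :=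
  ((2 * Real.pi * Real.exp (-2 * Real.pi * c * s) : ℝ) : ℂ) * φ (Real.exp (-2 * Real.pi * s))

theorem hasDerivAt_exp_neg_two_pi_mul (s : ℝ) :
    HasDerivAt (fun s : ℝ => Real.exp (-2 * Real.pi * s))
      (Real.exp (-2 * Real.pi * s) * (-2 * Real.pi)) s := by
  simpa using ((hasDerivAt_id s).const_mul (-2 * Real.pi)).exp

theorem exp_neg_two_pi_mul_injective :
    Function.Injective (fun s : ℝ => Real.exp (-2 * Real.pi * s)) := by
  intro a b h
  simpa [Real.pi_ne_zero] using h

/-- The preimage of a null set is its image under the differentiable map u ↦ -log u / (2π), hence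
null. This makes composition with an a.e. measurable φ legitimate. -/
theorem quasiMeasurePreserving_exp_neg_two_pi_mul :
    Measure.QuasiMeasurePreserving (fun s : ℝ => Real.exp (-2 * Real.pi * s)) volume
      (volume.restrict (Set.Ioi (0 : ℝ))) := by
  refine ⟨by fun_prop, Measure.AbsolutelyContinuous.mk fun N hN h0 => ?_⟩
  rw [Measure.map_apply (by fun_prop) hN]
  rw [Measure.restrict_apply hN] at h0
  have hd : DifferentiableOn ℝ (fun u : ℝ => Real.log u / (-2 * Real.pi)) (N ∩ Set.Ioi 0) :=
    fun u hu => ((Real.differentiableAt_log (ne_of_gt hu.2)).div_const _).differentiableWithinAt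
  refine measure_mono_null (fun s hs => ?_)
    (addHaar_image_eq_zero_of_differentiableOn_of_addHaar_eq_zero volume hd h0)
  refine ⟨Real.exp (-2 * Real.pi * s), ⟨hs, Real.exp_pos _⟩, ?_⟩
  have := Real.pi_ne_zero
  simp only [Real.log_exp]
  field_simp

theorem image_exp_neg_two_pi_mul_univ :
    (fun s : ℝ => Real.exp (-2 * Real.pi * s)) '' Set.univ = Set.Ioi 0 := by
  ext u
  simp only [Set.image_univ, Set.mem_range, Set.mem_Ioi]
  refine ⟨fun ⟨s, hs⟩ => hs ▸ Real.exp_pos _, fun hu => ⟨Real.log u / (-2 * Real.pi), ?_⟩⟩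
  rw [mul_div_cancel₀ _ (by simp), Real.exp_log hu]

theorem image_exp_neg_two_pi_mul_Icc {ρ : ℝ} (hρ : 0 < ρ) :
    (fun s : ℝ => Real.exp (-2 * Real.pi * s)) ''
      Set.Icc (-(Real.log ρ / (2 * Real.pi))) (Real.log ρ / (2 * Real.pi)) =
      Set.Icc (1 / ρ) ρ := by
  have hpi := Real.pi_pos
  ext u
  constructor
  · rintro ⟨s, ⟨h1, h2⟩, rfl⟩
    rw [neg_le, le_div_iff₀ (by positivity)] at h1
    rw [le_div_iff₀ (by positivity)] at h2
    refine ⟨?_, ?_⟩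
    · rw [one_div, ← Real.exp_log hρ, ← Real.exp_neg, Real.exp_le_exp]; linarith
    · conv_rhs => rw [← Real.exp_log hρ]
      simp only [Real.exp_le_exp]; linarith
  · rintro ⟨h1, h2⟩
    have hu : 0 < u := lt_of_lt_of_le (by positivity) h1
    have h3 := Real.log_le_log (by positivity) h1
    have h4 := Real.log_le_log hu h2
    rw [one_div, Real.log_inv] at h3
    refine ⟨Real.log u / (-2 * Real.pi), ⟨?_, ?_⟩, ?_⟩
    · rw [neg_le, ← div_neg, le_div_iff₀ (by positivity)]
      field_simp; linarith
    · rw [le_div_iff₀ (by positivity)]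
      field_simp; linarith
    · simp only
      rw [mul_div_cancel₀ _ (by simp), Real.exp_log hu]

theorem memLp_mellinPullback {c : ℝ} {φ : ℝ → ℂ} (hφ : φ ∈ MellinX 2 c) :
    MemLp (mellinPullback c φ) 2 volume := by
  have hpi := Real.pi_pos
  have hφ' : MemLp (fun u : ℝ => φ u * ((u ^ (c - 1 / 2) : ℝ) : ℂ)) 2
      (volume.restrict (Set.Ioi (0 : ℝ))) := by
    have := hφ
    simpa [MellinX] using this
  -- The factor e^{-πs} is u^{1/2}: its square is the Jacobian 2πu up to a constant, so squared
  -- norms match those of φ(u) u^{c-1/2}.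
  have e : mellinPullback c φ = fun s => ((2 * Real.pi * Real.exp (-Real.pi * s) : ℝ) : ℂ) *
      (φ (Real.exp (-2 * Real.pi * s)) * ((Real.exp (-2 * Real.pi * s) ^ (c - 1 / 2) : ℝ) : ℂ)) := by
    ext s
    have : 2 * Real.pi * Real.exp (-2 * Real.pi * c * s) = 2 * Real.pi * Real.exp (-Real.pi * s) *
        Real.exp (-2 * Real.pi * s) ^ (c - 1 / 2) := by
      rw [← Real.exp_mul, mul_assoc, mul_assoc _ (Real.exp _), ← Real.exp_add]
      ring_nf
    rw [mellinPullback, this]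
    push_cast
    ring
  have hm : AEStronglyMeasurable (mellinPullback c φ) volume := by
    rw [e]
    refine AEStronglyMeasurable.mul (Continuous.aestronglyMeasurable (by fun_prop)) ?_
    exact hφ'.1.comp_quasiMeasurePreserving quasiMeasurePreserving_exp_neg_two_pi_mul
  rw [memLp_two_iff_integrable_sq_norm hm]
  have h1 := (memLp_two_iff_integrable_sq_norm hφ'.1).1 hφ'
  change IntegrableOn _ (Set.Ioi (0 : ℝ)) volume at h1
  rw [← image_exp_neg_two_pi_mul_univ, integrableOn_image_iff_integrableOn_abs_deriv_smul
    MeasurableSet.univ (fun s _ => (hasDerivAt_exp_neg_two_pi_mul s).hasDerivWithinAt)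
    exp_neg_two_pi_mul_injective.injOn, integrableOn_univ] at h1
  refine (h1.const_mul (2 * Real.pi)).congr (Eventually.of_forall fun s => ?_)
  simp only [e, norm_mul, Complex.norm_real, Real.norm_eq_abs, Real.abs_exp, smul_eq_mul, abs_mul,
    abs_neg, abs_of_pos hpi, Nat.abs_ofNat]
  have : Real.exp (-2 * Real.pi * s) = Real.exp (-Real.pi * s) ^ 2 := by
    rw [← Real.exp_nat_mul]; ring_nf
  rw [this]
  ring

-- In the variable s, the range [1/ρ, ρ] is symmetric about 0 and du/u becomes 2π ds, the factor
-- built into `mellinPullback`.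
open scoped FourierTransform in
theorem truncatedMellin_eq_fourier (c : ℝ) (φ : ℝ → ℂ) {ρ : ℝ} (hρ : 0 < ρ) (t : ℝ) :
    truncatedMellin c φ ρ t = 𝓕 ((Set.Icc (-(Real.log ρ / (2 * Real.pi)))
      (Real.log ρ / (2 * Real.pi))).indicator (mellinPullback c φ)) t := by
  have hpi := Real.pi_pos
  rw [truncatedMellin, ← image_exp_neg_two_pi_mul_Icc hρ, integral_image_eq_integral_abs_deriv_smul
    measurableSet_Icc (fun s _ => (hasDerivAt_exp_neg_two_pi_mul s).hasDerivWithinAt)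
    exp_neg_two_pi_mul_injective.injOn, Real.fourier_real_eq_integral_exp_smul,
    ← integral_indicator measurableSet_Icc]
  congr 1
  ext s
  by_cases hs : s ∈ Set.Icc (-(Real.log ρ / (2 * Real.pi))) (Real.log ρ / (2 * Real.pi))
  · rw [Set.indicator_of_mem hs, Set.indicator_of_mem hs, mellinPullback]
    have h0 : ((Real.exp (-2 * Real.pi * s) : ℝ) : ℂ) ≠ 0 := by
      exact_mod_cast (Real.exp_pos _).ne'
    rw [Complex.cpow_def_of_ne_zero h0, ← Complex.ofReal_log (Real.exp_pos _).le, Real.log_exp,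
      abs_mul, Real.abs_exp, abs_mul, abs_neg, abs_of_pos hpi, Nat.abs_ofNat, Complex.real_smul,
      smul_eq_mul]
    have e1 : ∀ A B P : ℂ, Complex.exp A * (2 * (Real.pi : ℂ)) * (P * Complex.exp B) =
        2 * (Real.pi : ℂ) * (Complex.exp (A + B)) * P := fun A B P => by
      rw [Complex.exp_add]; ring
    have e2 : ∀ A B P : ℂ, Complex.exp A * (2 * (Real.pi : ℂ) * Complex.exp B * P) =
        2 * (Real.pi : ℂ) * (Complex.exp (A + B)) * P := fun A B P => by
      rw [Complex.exp_add]; ring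
    push_cast
    rw [e1, e2]
    congr 3
    ring
  · rw [Set.indicator_of_notMem hs, Set.indicator_of_notMem hs, smul_zero]

open scoped FourierTransform in
/-- The `L²`-Mellin transform is the `L²`-Fourier transform of `mellinPullback`. -/
theorem isMellinTransformL2_fourier {c : ℝ} {φ : ℝ → ℂ} (hφ : φ ∈ MellinX 2 c) :
    IsMellinTransformL2 c φ
      (𝓕 ((memLp_mellinPullback hφ).toLp (mellinPullback c φ)) : Lp ℂ 2 (volume : Measure ℝ)) := by
  have hψ := memLp_mellinPullback hφ
  refine ⟨Lp.memLp _, ?_⟩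
  have hlog : Tendsto (fun ρ : ℝ => Real.log ρ / (2 * Real.pi)) atTop atTop :=
    Real.tendsto_log_atTop.atTop_div_const (by positivity)
  have hlim := tendsto_eLpNorm_two_sub_of_dominated (l := atTop) (f := fun ρ : ℝ =>
    (Set.Icc (-(Real.log ρ / (2 * Real.pi)))
      (Real.log ρ / (2 * Real.pi))).indicator (mellinPullback c φ)) hψ
    (Eventually.of_forall fun ρ => hψ.1.indicator measurableSet_Icc)
    (Eventually.of_forall fun ρ s => norm_indicator_le_norm_self _ _) (fun s => by
      refine tendsto_const_nhds.congr' ?_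
      filter_upwards [hlog.eventually_ge_atTop |s|] with ρ hρ
      exact (Set.indicator_of_mem (Set.mem_Icc.2 (abs_le.1 hρ)) _).symm)
  refine hlim.congr' ?_
  filter_upwards [eventually_gt_atTop 0] with ρ hρ
  have h2 := hψ.indicator (s := Set.Icc (-(Real.log ρ / (2 * Real.pi)))
      (Real.log ρ / (2 * Real.pi))) measurableSet_Icc
  have h1 : Integrable ((Set.Icc (-(Real.log ρ / (2 * Real.pi)))
      (Real.log ρ / (2 * Real.pi))).indicator (mellinPullback c φ)) := by
    rw [integrable_indicator_iff measurableSet_Icc]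
    exact (hψ.restrict _).integrable (by norm_num)
  rw [← eLpNorm_fourier_sub hψ h1 h2]
  simp only [truncatedMellin_eq_fourier c φ hρ]

/-! ### Polar-analytic functions as entire functions of log r + iθ -/

theorem exp_log_add_mul_I {z : ℝ × ℝ} (hz : 0 < z.1) :
    Complex.exp ((Real.log z.1 : ℂ) + z.2 * Complex.I) = polarPoint z := by
  rw [Complex.exp_add, ← Complex.ofReal_exp, Real.exp_log hz, polarPoint]

theorem polarPoint_exp (w : ℂ) : polarPoint (Real.exp w.re, w.im) = Complex.exp w := by
  conv_rhs => rw [← Complex.re_add_im w, Complex.exp_add]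
  simp [polarPoint]

/-- An entire function of `log r + iθ` is polar-analytic. -/
theorem Differentiable.polarAnalyticOn {F : ℂ → ℂ} (hF : Differentiable ℂ F) :
    PolarAnalyticOn (fun z => F ((Real.log z.1 : ℂ) + z.2 * Complex.I)) polarPlane := by
  intro z₀ hz₀
  have hz₀' : 0 < z₀.1 := hz₀
  set w₀ : ℂ := (Real.log z₀.1 : ℂ) + z₀.2 * Complex.I with hw₀
  have hℓ : Tendsto (fun z : ℝ × ℝ => (Real.log z.1 : ℂ) + z.2 * Complex.I)
      (𝓝[polarPlane \ {z₀}] z₀) (𝓝[≠] w₀) := by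
    refine tendsto_nhdsWithin_iff.2 ⟨?_, ?_⟩
    · refine Tendsto.mono_left ?_ nhdsWithin_le_nhds
      have h1 : ContinuousAt (fun z : ℝ × ℝ => Real.log z.1) z₀ :=
        continuousAt_fst.log hz₀'.ne'
      have h2 : ContinuousAt (fun z : ℝ × ℝ => (Real.log z.1 : ℂ) + z.2 * Complex.I) z₀ :=
        (Complex.continuous_ofReal.continuousAt.comp h1).add (by fun_prop)
      exact h2
    · filter_upwards [self_mem_nhdsWithin] with z hz h
      have hz1 : 0 < z.1 := hz.1
      apply hz.2
      have hre := congrArg Complex.re h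
      have him := congrArg Complex.im h
      simp only [hw₀, Complex.add_re, Complex.ofReal_re, Complex.mul_re, Complex.I_re, mul_zero,
        Complex.ofReal_im, Complex.I_im, mul_one, sub_self, add_zero, Complex.add_im,
        Complex.mul_im, zero_add] at hre him
      exact Prod.ext (Real.log_injOn_pos hz1 hz₀' hre) him
  -- The polar quotient is the slope of F divided by the slope of exp, with limit F'(w₀)/e^{w₀}.
  have hq := ((hF w₀).hasDerivAt.tendsto_slope.comp hℓ).div
    ((Complex.hasDerivAt_exp w₀).tendsto_slope.comp hℓ) (Complex.exp_ne_zero _)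
  refine ⟨_, hq.congr' ?_⟩
  filter_upwards [self_mem_nhdsWithin, hℓ.eventually self_mem_nhdsWithin] with z hz hne
  have hz1 : 0 < z.1 := hz.1
  simp only [Pi.div_apply, Function.comp_apply, slope_def_field]
  rw [div_div_div_cancel_right₀ (sub_ne_zero.2 hne), exp_log_add_mul_I hz1, hw₀,
    exp_log_add_mul_I hz₀']

/-- A polar-analytic function on `ℍ` is an entire function of `log r + iθ`. -/
theorem PolarAnalyticOn.differentiable {f : ℝ × ℝ → ℂ} (hf : PolarAnalyticOn f polarPlane) :
    Differentiable ℂ (fun w : ℂ => f (Real.exp w.re, w.im)) := by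
  intro w₀
  obtain ⟨d, hd⟩ := hf (Real.exp w₀.re, w₀.im) (Real.exp_pos _)
  have hm : Tendsto (fun w : ℂ => (Real.exp w.re, w.im)) (𝓝[≠] w₀)
      (𝓝[polarPlane \ {(Real.exp w₀.re, w₀.im)}] (Real.exp w₀.re, w₀.im)) := by
    refine tendsto_nhdsWithin_iff.2 ⟨?_, ?_⟩
    · have : Continuous (fun w : ℂ => (Real.exp w.re, w.im)) :=
        (Real.continuous_exp.comp Complex.continuous_re).prodMk Complex.continuous_im
      exact (this.tendsto w₀).mono_left nhdsWithin_le_nhds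
    · filter_upwards [self_mem_nhdsWithin] with w hw
      refine ⟨Real.exp_pos _, fun h => hw ?_⟩
      have h' := Prod.ext_iff.1 (Set.mem_singleton_iff.1 h)
      exact Complex.ext (Real.exp_injective h'.1) h'.2
  have he := (Complex.hasDerivAt_exp w₀).tendsto_slope
  have hq := (hd.comp hm).mul he
  refine HasDerivAt.differentiableAt (f' := d * Complex.exp w₀) (hasDerivAt_iff_tendsto_slope.2
    (hq.congr' ?_))
  -- Since exp is injective only locally, the polar denominator is known to be nonzero only near w₀.
  filter_upwards [self_mem_nhdsWithin, (Complex.hasDerivAt_exp w₀).eventually_ne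
    (c := Complex.exp w₀) (Complex.exp_ne_zero _)] with w hw hne
  simp only [Function.comp_apply, slope_def_field, polarPoint_exp]
  exact div_mul_div_cancel₀ (sub_ne_zero.2 hne)

/-! ### From band-limited to exponential type -/

/-- The holomorphic extension of the inverse Fourier integral of a function on `[-T, T]`. -/
theorem differentiable_integral_Icc_exp {g : ℝ → ℂ} {T : ℝ} (hg : IntegrableOn g (Set.Icc (-T) T)) :
    Differentiable ℂ (fun z : ℂ => ∫ t in Set.Icc (-T) T,
      g t * Complex.exp (2 * Real.pi * Complex.I * t * z)) := by
  intro z₀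
  have hm : ∀ z : ℂ, AEStronglyMeasurable
      (fun t : ℝ => g t * Complex.exp (2 * Real.pi * Complex.I * t * z))
      (volume.restrict (Set.Icc (-T) T)) := fun z =>
    hg.1.mul (Continuous.aestronglyMeasurable (by fun_prop))
  have hexp : ∀ t ∈ Set.Icc (-T) T, ∀ z ∈ Metric.ball z₀ 1,
      ‖Complex.exp (2 * Real.pi * Complex.I * t * z)‖ ≤ Real.exp (2 * Real.pi * T * (‖z₀‖ + 1)) := by
    intro t ht z hz
    rw [Complex.norm_exp]
    refine Real.exp_le_exp.2 ((Complex.re_le_norm _).trans ?_)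
    have h1 : ‖z‖ ≤ ‖z₀‖ + 1 := by
      have := norm_sub_norm_le z z₀
      rw [mem_ball_iff_norm] at hz
      linarith
    have h2 : |t| ≤ T := abs_le.2 ht
    rw [norm_mul]
    simp only [norm_mul, Complex.norm_ofNat, Complex.norm_real, Real.norm_eq_abs, Complex.norm_I,
      abs_of_pos Real.pi_pos, mul_one]
    have hpi := Real.pi_pos
    have h3 : 0 ≤ T := (abs_nonneg t).trans h2
    gcongr
  refine (hasDerivAt_integral_of_dominated_loc_of_deriv_le
    (F' := fun z t => g t * (Complex.exp (2 * Real.pi * Complex.I * t * z) *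
      (2 * Real.pi * Complex.I * t)))
    (bound := fun t => ‖g t‖ * (Real.exp (2 * Real.pi * T * (‖z₀‖ + 1)) * (2 * Real.pi * T)))
    (Metric.ball_mem_nhds z₀ one_pos) (Eventually.of_forall hm) ?_ ?_ ?_ ?_ ?_).2.differentiableAt
  · refine hg.mul_bdd (c := Real.exp (2 * Real.pi * T * (‖z₀‖ + 1)))
      (Continuous.aestronglyMeasurable (by fun_prop)) ?_
    filter_upwards [ae_restrict_mem measurableSet_Icc] with t ht
    exact hexp t ht z₀ (Metric.mem_ball_self one_pos)
  · exact hg.1.mul (Continuous.aestronglyMeasurable (by fun_prop))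
  · filter_upwards [ae_restrict_mem measurableSet_Icc] with t ht z hz
    have h2 : |t| ≤ T := abs_le.2 ht
    have hpi := Real.pi_pos
    rw [norm_mul, norm_mul]
    have h3 : ‖(2 * Real.pi * Complex.I * t : ℂ)‖ ≤ 2 * Real.pi * T := by
      simp only [norm_mul, Complex.norm_ofNat, Complex.norm_real, Real.norm_eq_abs, Complex.norm_I,
        abs_of_pos Real.pi_pos, mul_one]
      gcongr
    gcongr
    exact hexp t ht z hz
  · exact hg.norm.mul_const _
  · refine Eventually.of_forall fun t z _ => ?_
    have := ((hasDerivAt_id z).const_mul (2 * Real.pi * Complex.I * t : ℂ)).cexp.const_mul (g t)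
    simpa using this

/-- The kernel has modulus e^{-2πt Im z}, at most e^{2πT|Im z|} when |t| ≤ T. -/
theorem norm_integral_Icc_exp_le {g : ℝ → ℂ} {T : ℝ} (hg : IntegrableOn g (Set.Icc (-T) T))
    (z : ℂ) :
    ‖∫ t in Set.Icc (-T) T, g t * Complex.exp (2 * Real.pi * Complex.I * t * z)‖ ≤
      (∫ t in Set.Icc (-T) T, ‖g t‖) * Real.exp (2 * Real.pi * T * |z.im|) := by
  rw [← integral_mul_const]
  refine norm_integral_le_of_norm_le (hg.norm.mul_const _) ?_
  filter_upwards [ae_restrict_mem measurableSet_Icc] with t ht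
  rw [norm_mul, Complex.norm_exp]
  have h2 : |t| ≤ T := abs_le.2 ht
  have hpi := Real.pi_pos
  gcongr
  have : (2 * Real.pi * Complex.I * t * z : ℂ).re = 2 * Real.pi * -(t * z.im) := by
    have : (2 * Real.pi * Complex.I * t * z : ℂ) = ((2 * Real.pi * t : ℝ) : ℂ) * (z * Complex.I) := by
      push_cast; ring
    rw [this, Complex.re_ofReal_mul]
    simp
    ring
  rw [this, mul_assoc _ T]
  refine mul_le_mul_of_nonneg_left (a := 2 * Real.pi) ?_ (by positivity)
  calc -(t * z.im) ≤ |t * z.im| := neg_le_abs _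
    _ = |t| * |z.im| := abs_mul _ _
    _ ≤ T * |z.im| := by gcongr

open scoped FourierTransform in
/-- A function whose Mellin transform is supported in `[-T, T]` extends to a member of the
Mellin–Bernstein space. -/
theorem exists_mellinBernstein_of_mellinPaleyWiener {c T : ℝ} {φ : ℝ → ℂ}
    (hφ : φ ∈ MellinPaleyWiener c T) :
    ∃ f ∈ MellinBernstein 2 c T, ∀ r : ℝ, 0 < r → f (r, 0) = φ r := by
  obtain ⟨hX, hcont, g, hg, hg0⟩ := hφ
  have hpi := Real.pi_pos
  have hg2 : IntegrableOn g (Set.Icc (-T) T) := (hg.1.restrict _).integrable (by norm_num)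
  have hψ := memLp_mellinPullback hX
  have hind : g =ᵐ[volume] (Set.Icc (-T) T).indicator g := by
    filter_upwards [hg0] with t ht
    by_cases h : t ∈ Set.Icc (-T) T
    · rw [Set.indicator_of_mem h]
    · rw [Set.indicator_of_notMem h]
      exact ht (not_le.1 fun h' => h (abs_le.1 h'))
  have hint : Integrable ((Set.Icc (-T) T).indicator g) :=
    (integrable_indicator_iff measurableSet_Icc).2 hg2
  have hae := ae_eq_fourierInv_of_fourier hψ hint
    (((isMellinTransformL2_fourier hX).ae_eq hX hg).trans hind)
  have hc1 : Continuous (mellinPullback c φ) := by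
    refine Continuous.mul (by fun_prop) ?_
    exact hcont.comp_continuous (by fun_prop) fun s => Real.exp_pos _
  have hc2 : Continuous (𝓕⁻ ((Set.Icc (-T) T).indicator g)) :=
    VectorFourier.fourierIntegral_continuous
      Real.continuous_fourierChar (L := -innerₗ ℝ) (by exact continuous_inner.neg) hint
  -- Continuity of φ upgrades a.e. equality to equality everywhere.
  have heq := (hc1.ae_eq_iff_eq volume hc2).1 hae
  set H : ℂ → ℂ := fun z => ∫ t in Set.Icc (-T) T,
    g t * Complex.exp (2 * Real.pi * Complex.I * t * z) with hH
  have hHd : Differentiable ℂ H := differentiable_integral_Icc_exp hg2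
  have hHs : ∀ s : ℝ, H s = mellinPullback c φ s := by
    intro s
    rw [heq, Real.fourierInv_eq', hH]
    simp only
    rw [← integral_indicator measurableSet_Icc]
    congr 1
    ext t
    by_cases h : t ∈ Set.Icc (-T) T
    · rw [Set.indicator_of_mem h, Set.indicator_of_mem h, smul_eq_mul, mul_comm]
      congr 2
      simp only [RCLike.inner_apply, conj_trivial]
      push_cast
      ring
    · rw [Set.indicator_of_notMem h, Set.indicator_of_notMem h, smul_zero]
  -- This undoes `mellinPullback` at s = -w/(2π), with w in place of log r.
  set F : ℂ → ℂ := fun w => (1 / (2 * Real.pi) : ℂ) * Complex.exp (-c * w) *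
    H (-w / (2 * Real.pi)) with hF
  have hFd : Differentiable ℂ F :=
    ((differentiable_id.const_mul (-c : ℂ)).cexp.const_mul _).mul
      (hHd.comp (differentiable_id.neg.div_const _))
  have hFφ : ∀ r : ℝ, 0 < r → F ((Real.log r : ℂ) + (0 : ℝ) * Complex.I) = φ r := by
    intro r hr
    have h1 : -(Real.log r : ℂ) / (2 * Real.pi) = ((-Real.log r / (2 * Real.pi) : ℝ) : ℂ) := by
      push_cast; ring
    have h2 : -2 * Real.pi * c * (-Real.log r / (2 * Real.pi)) = c * Real.log r := by
      field_simp
    have h3 : -2 * Real.pi * (-Real.log r / (2 * Real.pi)) = Real.log r := by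
      field_simp
    simp only [hF, Complex.ofReal_zero, zero_mul, add_zero]
    rw [h1, hHs, mellinPullback, h2, h3, Real.exp_log hr]
    push_cast
    have h4 : Complex.exp (-c * Real.log r) * Complex.exp (c * Real.log r) = 1 := by
      rw [← Complex.exp_add]; simp
    have h5 : (Real.pi : ℂ) ≠ 0 := by exact_mod_cast hpi.ne'
    calc _ = (1 / (2 * Real.pi) * (2 * Real.pi)) *
          (Complex.exp (-c * Real.log r) * Complex.exp (c * Real.log r)) * φ r := by ring
      _ = φ r := by rw [h4]; field_simp
  refine ⟨fun z => F ((Real.log z.1 : ℂ) + z.2 * Complex.I), ⟨hFd.polarAnalyticOn, ?_, ?_⟩, hFφ⟩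
  · refine (memLp_congr_ae ?_).1 hX
    filter_upwards [ae_restrict_mem measurableSet_Ioi] with r hr
    rw [hFφ r hr]
  -- Adding 1 keeps the constant positive even when g vanishes.
  · refine ⟨(1 / (2 * Real.pi)) * (∫ t in Set.Icc (-T) T, ‖g t‖) + 1, by positivity,
      fun r θ hr => ?_⟩
    have hb := norm_integral_Icc_exp_le hg2 (-((Real.log r : ℂ) + θ * Complex.I) / (2 * Real.pi))
    have him : (-((Real.log r : ℂ) + θ * Complex.I) / (2 * Real.pi)).im = -θ / (2 * Real.pi) := by
      rw [show (2 * Real.pi : ℂ) = ((2 * Real.pi : ℝ) : ℂ) by push_cast; ring,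
        Complex.div_ofReal_im]
      simp
    have hE : 2 * Real.pi * T * |-θ / (2 * Real.pi)| = T * |θ| := by
      rw [abs_div, abs_neg, abs_of_pos (by positivity : 0 < 2 * Real.pi)]
      field_simp
    rw [him, hE] at hb
    have hn : ‖Complex.exp (-c * ((Real.log r : ℂ) + θ * Complex.I))‖ = r ^ (-c) := by
      rw [Complex.norm_exp, Real.rpow_def_of_pos hr]
      simp [mul_comm]
    have hn2 : ‖(1 / (2 * Real.pi) : ℂ)‖ = 1 / (2 * Real.pi) := by
      simp [abs_of_pos hpi]
    simp only [hF]
    rw [norm_mul, norm_mul, hn, hn2]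
    calc 1 / (2 * Real.pi) * r ^ (-c) * ‖H (-((Real.log r : ℂ) + θ * Complex.I) / (2 * Real.pi))‖
        ≤ 1 / (2 * Real.pi) * r ^ (-c) *
          ((∫ t in Set.Icc (-T) T, ‖g t‖) * Real.exp (T * |θ|)) := by gcongr
      _ = (1 / (2 * Real.pi) * (∫ t in Set.Icc (-T) T, ‖g t‖)) * r ^ (-c) *
          Real.exp (T * |θ|) := by ring
      _ ≤ _ := by gcongr; linarith

/-! ### From exponential type to band-limited -/

theorem integrable_inv_one_add_mul_sq {ε : ℝ} (hε : 0 < ε) :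
    Integrable (fun x : ℝ => (1 + (ε * x) ^ 2)⁻¹) :=
  integrable_inv_one_add_sq.comp_mul_left' hε.ne'

/-- A function which decays like `e^{-ay} / (1 + ε²x²)` in the lower half plane has vanishing
integral over the real line. -/
theorem integral_eq_zero_of_decay_lower_half_plane {k : ℂ → ℂ} {C ε a : ℝ} (hε : 0 < ε)
    (ha : 0 < a) (hC : 0 ≤ C) (hd : DifferentiableOn ℂ k {z | z.im ≤ 0})
    (hb : ∀ z : ℂ, z.im ≤ 0 → ‖k z‖ ≤ C * Real.exp (a * z.im) * (1 + (ε * z.re) ^ 2)⁻¹) :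
    ∫ x : ℝ, k x = 0 := by
  have hcy : ∀ y : ℝ, y ≤ 0 → Continuous (fun x : ℝ => k (x + y * Complex.I)) := fun y hy =>
    hd.continuousOn.comp_continuous (by fun_prop) fun x => by simpa using hy
  have hint : ∀ y : ℝ, y ≤ 0 → Integrable (fun x : ℝ => k (x + y * Complex.I)) := fun y hy =>
    ((integrable_inv_one_add_mul_sq hε).const_mul (C * Real.exp (a * y))).mono'
      (hcy y hy).aestronglyMeasurable (Eventually.of_forall fun x => by
        simpa using hb (x + y * Complex.I) (by simpa using hy))
  have hshift : ∀ y : ℝ, y ≤ 0 → ∫ x : ℝ, k x = ∫ x : ℝ, k (x + y * Complex.I) := by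
    intro y hy
    have hrect : ∀ R : ℝ, (∫ x : ℝ in -R..R, k (x + y * Complex.I)) - (∫ x : ℝ in -R..R, k x) +
        Complex.I • (∫ v : ℝ in y..0, k ((R : ℝ) + v * Complex.I)) -
        Complex.I • (∫ v : ℝ in y..0, k ((-R : ℝ) + v * Complex.I)) = 0 := by
      intro R
      have := Complex.integral_boundary_rect_eq_zero_of_differentiableOn k
        ((-R : ℝ) + y * Complex.I) ((R : ℝ) + (0 : ℝ) * Complex.I) (hd.mono fun z hz => by
          have h2 := hz.2
          simp only [Complex.add_im, Complex.ofReal_im, Complex.mul_im, Complex.ofReal_re,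
            Complex.I_im, mul_one, Complex.I_re, mul_zero, add_zero, zero_add, Set.mem_preimage,
            Set.uIcc_of_le hy] at h2
          exact h2.2)
      simpa using this
    -- The sign σ = ±1 treats both vertical sides of the rectangle at once.
    have hvert : ∀ σ : ℝ, σ ^ 2 = 1 → Tendsto (fun R : ℝ =>
        Complex.I • (∫ v : ℝ in y..0, k ((σ * R : ℝ) + v * Complex.I))) atTop (𝓝 0) := by
      intro σ hσ
      have hz : Tendsto (fun R : ℝ => C * (1 + (ε * R) ^ 2)⁻¹ * |0 - y|) atTop (𝓝 0) := by
        have h1 : Tendsto (fun R : ℝ => 1 + (ε * R) ^ 2) atTop atTop :=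
          tendsto_atTop_add_const_left _ _ ((tendsto_pow_atTop two_ne_zero).comp
            (tendsto_id.const_mul_atTop hε))
        simpa using (h1.inv_tendsto_atTop.const_mul C).mul_const |0 - y|
      refine squeeze_zero_norm (fun R => ?_) hz
      rw [norm_smul, Complex.norm_I, one_mul]
      refine intervalIntegral.norm_integral_le_of_norm_le_const fun v hv => ?_
      rw [Set.uIoc_of_le hy] at hv
      have := hb ((σ * R : ℝ) + v * Complex.I) (by simpa using hv.2)
      simp only [Complex.add_im, Complex.ofReal_im, Complex.mul_im, Complex.ofReal_re,
        Complex.I_im, mul_one, Complex.I_re, mul_zero, add_zero, zero_add, Complex.add_re,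
        Complex.mul_re, sub_self] at this
      refine this.trans ?_
      have h2 : (ε * (σ * R)) ^ 2 = (ε * R) ^ 2 := by linear_combination (ε * R) ^ 2 * hσ
      rw [h2]
      have h3 : Real.exp (a * v) ≤ 1 :=
        Real.exp_le_one_iff.2 (mul_nonpos_of_nonneg_of_nonpos ha.le hv.2)
      have h4 : C * Real.exp (a * v) ≤ C * 1 := by gcongr
      rw [mul_one] at h4
      gcongr
    have h1 := intervalIntegral_tendsto_integral (hint y hy) tendsto_neg_atTop_atBot tendsto_id
    have h0 : Integrable (fun x : ℝ => k x) := by simpa using hint 0 le_rfl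
    have h2 := intervalIntegral_tendsto_integral h0 tendsto_neg_atTop_atBot tendsto_id
    have h3 := hvert 1 (by norm_num)
    have h4 := hvert (-1) (by norm_num)
    have h5 := ((h1.sub h2).add h3).sub h4
    have h6 := h5.congr (f₂ := fun _ => (0 : ℂ)) fun R => by
      simpa using hrect R
    have h7 := tendsto_nhds_unique h6 tendsto_const_nhds
    simp only [add_zero, sub_zero] at h7
    exact (sub_eq_zero.1 h7).symm
  have hle : ∀ y : ℝ, 0 ≤ y → ‖∫ x : ℝ, k x‖ ≤
      C * Real.exp (-(a * y)) * ∫ x : ℝ, (1 + (ε * x) ^ 2)⁻¹ := by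
    intro y hy
    rw [hshift (-y) (by linarith), ← integral_const_mul]
    refine norm_integral_le_of_norm_le ((integrable_inv_one_add_mul_sq hε).const_mul _)
      (Eventually.of_forall fun x => ?_)
    simpa using hb (x + (-y : ℝ) * Complex.I) (by simpa using hy)
  have hlim : Tendsto (fun y : ℝ => C * Real.exp (-(a * y)) * ∫ x : ℝ, (1 + (ε * x) ^ 2)⁻¹)
      atTop (𝓝 0) := by
    have := (Real.tendsto_exp_neg_atTop_nhds_zero.comp
      (tendsto_id.const_mul_atTop ha)).const_mul C |>.mul_const (∫ x : ℝ, (1 + (ε * x) ^ 2)⁻¹)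
    simpa using this
  exact norm_le_zero_iff.1 (ge_of_tendsto hlim ((eventually_ge_atTop 0).mono hle))

theorem norm_one_add_I_mul_sq (x : ℝ) : ‖(1 + Complex.I * x) ^ 2‖ = 1 + x ^ 2 := by
  rw [norm_pow, ← Complex.normSq_eq_norm_sq, Complex.normSq_apply]
  simp
  ring

open scoped FourierTransform in
/-- The regularized restriction of an entire function of exponential type `2πT` bounded on the
real line has no frequencies above `T`. -/
theorem fourier_div_one_add_I_mul_sq_eq_zero {h : ℂ → ℂ} {C T ε t : ℝ} (hd : Differentiable ℂ h)
    (hb : ∀ z, ‖h z‖ ≤ C * Real.exp (2 * Real.pi * T * |z.im|)) (hε : 0 < ε) (ht : T < t) :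
    𝓕 (fun s : ℝ => (h s / (1 + Complex.I * ((ε * s : ℝ) : ℂ)) ^ 2 : ℂ)) t = 0 := by
  have hpi := Real.pi_pos
  have hC : 0 ≤ C := by
    have := (norm_nonneg _).trans (hb 0)
    simpa using this
  -- With z = x + iy the norm is (1 - εy)² + (εx)², and y ≤ 0.
  have hden : ∀ z : ℂ, z.im ≤ 0 → 1 + (ε * z.re) ^ 2 ≤ ‖(1 + Complex.I * (ε * z)) ^ 2‖ := by
    intro z hz
    rw [norm_pow, ← Complex.normSq_eq_norm_sq, Complex.normSq_apply]
    simp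
    nlinarith [mul_nonneg hε.le (neg_nonneg.2 hz)]
  have hpos : ∀ z : ℂ, 0 < 1 + (ε * z.re) ^ 2 := fun z => by positivity
  rw [Real.fourier_real_eq_integral_exp_smul]
  have := integral_eq_zero_of_decay_lower_half_plane (ε := ε) (a := 2 * Real.pi * (t - T)) (C := C)
    (k := fun z => Complex.exp (-2 * Real.pi * z * t * Complex.I) *
      (h z / (1 + Complex.I * (ε * z)) ^ 2)) hε (mul_pos (by positivity) (sub_pos.2 ht)) hC ?_ ?_
  · rw [← this]
    congr 1
    ext s
    simp
  · intro z hz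
    refine DifferentiableAt.differentiableWithinAt ?_
    refine DifferentiableAt.mul (by fun_prop) (DifferentiableAt.div (hd z) (by fun_prop) ?_)
    exact norm_pos_iff.1 ((hpos z).trans_le (hden z hz))
  · intro z hz
    have h1 := hb z
    rw [abs_of_nonpos hz] at h1
    rw [norm_mul, norm_div, Complex.norm_exp]
    have hre : (-2 * Real.pi * z * t * Complex.I : ℂ).re = 2 * Real.pi * t * z.im := by
      have : (-2 * Real.pi * z * t * Complex.I : ℂ) =
          ((-2 * Real.pi * t : ℝ) : ℂ) * (z * Complex.I) := by push_cast; ring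
      rw [this, Complex.re_ofReal_mul]
      simp
    rw [hre, ← div_eq_mul_inv]
    calc Real.exp (2 * Real.pi * t * z.im) * (‖h z‖ / ‖(1 + Complex.I * (ε * z)) ^ 2‖)
        ≤ Real.exp (2 * Real.pi * t * z.im) *
          ((C * Real.exp (2 * Real.pi * T * -z.im)) / (1 + (ε * z.re) ^ 2)) := by
          gcongr
          exact hden z hz
      _ = C * (Real.exp (2 * Real.pi * t * z.im) * Real.exp (2 * Real.pi * T * -z.im)) /
          (1 + (ε * z.re) ^ 2) := by ring
      _ = _ := by
          rw [← Real.exp_add]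
          ring_nf

-- By Plancherel, the L² norm of 𝓕ψ on S is at most ‖ψ - f n‖₂, which tends to 0 by dominated
-- convergence.
open scoped FourierTransform in
theorem fourier_toLp_ae_eq_zero_of_approx {ψ : ℝ → ℂ} (hψ : MemLp ψ 2 volume) {f : ℕ → ℝ → ℂ}
    (h1 : ∀ n, Integrable (f n)) (hb : ∀ n s, ‖f n s‖ ≤ ‖ψ s‖)
    (hlim : ∀ s, Tendsto (fun n => f n s) atTop (𝓝 (ψ s))) {S : Set ℝ} (hS : MeasurableSet S)
    (h0 : ∀ n, ∀ t ∈ S, 𝓕 (f n) t = 0) :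
    ∀ᵐ t, t ∈ S → (𝓕 (hψ.toLp ψ) : Lp ℂ 2 (volume : Measure ℝ)) t = 0 := by
  have hl := tendsto_eLpNorm_two_sub_of_dominated hψ (l := atTop)
    (Eventually.of_forall fun n => (h1 n).1) (Eventually.of_forall hb) hlim
  have hle : ∀ n, eLpNorm (𝓕 (hψ.toLp ψ) : Lp ℂ 2 (volume : Measure ℝ)) 2 (volume.restrict S) ≤
      eLpNorm (fun s => ψ s - f n s) 2 volume := by
    intro n
    rw [← eLpNorm_fourier_sub hψ (h1 n) (hψ.mono (h1 n).1 (Eventually.of_forall (hb n)))]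
    refine le_trans (le_of_eq ?_) (eLpNorm_mono_measure _ (Measure.restrict_le_self (s := S)))
    refine eLpNorm_congr_ae ?_
    filter_upwards [ae_restrict_mem hS] with t ht
    rw [h0 n t ht, sub_zero]
  have hz := le_antisymm (ge_of_tendsto' hl hle) bot_le
  rw [← ae_restrict_iff' hS]
  exact (eLpNorm_eq_zero_iff (Lp.aestronglyMeasurable _).restrict (by norm_num)).1 hz

open scoped FourierTransform in
/-- **Paley–Wiener**: an entire function of exponential type `2πT`, bounded and square integrable
on the real line, has its Fourier transform supported in `[-T, T]`. -/
theorem fourier_toLp_ae_eq_zero_of_exp_type {h : ℂ → ℂ} {C T : ℝ} (hd : Differentiable ℂ h)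
    (hb : ∀ z, ‖h z‖ ≤ C * Real.exp (2 * Real.pi * T * |z.im|))
    {ψ : ℝ → ℂ} (hψ : MemLp ψ 2 volume) (hhψ : ∀ s : ℝ, h s = ψ s) :
    ∀ᵐ t, T < |t| → (𝓕 (hψ.toLp ψ) : Lp ℂ 2 (volume : Measure ℝ)) t = 0 := by
  have hψb : ∀ s, ‖ψ s‖ ≤ C := fun s => by
    have := hb s
    simpa [hhψ] using this
  have hψc : Continuous ψ := by
    have : ψ = fun s : ℝ => h s := funext fun s => (hhψ s).symm
    rw [this]
    exact hd.continuous.comp Complex.continuous_ofReal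
  -- Taking σ = 1 puts the pole in the upper half plane, for t > T; σ = -1 puts it in the lower one,
  -- for t < -T.
  set f : ℝ → ℕ → ℝ → ℂ := fun σ n s =>
    ψ s / (1 + Complex.I * ((σ * (1 / ((n : ℝ) + 1)) * s : ℝ) : ℂ)) ^ 2 with hf
  have hε : ∀ n : ℕ, (0 : ℝ) < 1 / ((n : ℝ) + 1) := fun n => by positivity
  have hnorm : ∀ σ n s, ‖f σ n s‖ = ‖ψ s‖ * (1 + (σ * (1 / ((n : ℝ) + 1)) * s) ^ 2)⁻¹ :=
    fun σ n s => by
      simp only [hf]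
      rw [norm_div, norm_one_add_I_mul_sq, div_eq_mul_inv]
  have hfb : ∀ σ n s, ‖f σ n s‖ ≤ ‖ψ s‖ := fun σ n s => by
    rw [hnorm]
    refine mul_le_of_le_one_right (norm_nonneg _) (inv_le_one_of_one_le₀ ?_)
    nlinarith [sq_nonneg (σ * (1 / ((n : ℝ) + 1)) * s)]
  have hfi : ∀ σ : ℝ, σ ^ 2 = 1 → ∀ n, Integrable (f σ n) := by
    intro σ hσ n
    refine ((integrable_inv_one_add_mul_sq (hε n)).const_mul C).mono'
      (Continuous.aestronglyMeasurable ?_) (Eventually.of_forall fun s => ?_)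
    · refine hψc.div (by fun_prop) fun s => ?_
      rw [← norm_pos_iff, norm_one_add_I_mul_sq]
      positivity
    · rw [hnorm]
      have : (σ * (1 / ((n : ℝ) + 1)) * s) ^ 2 = (1 / ((n : ℝ) + 1) * s) ^ 2 := by
        linear_combination (1 / ((n : ℝ) + 1) * s) ^ 2 * hσ
      rw [this]
      gcongr
      exact hψb s
  have hlim : ∀ σ s, Tendsto (fun n => f σ n s) atTop (𝓝 (ψ s)) := by
    intro σ s
    have h1 : Tendsto (fun n : ℕ => σ * (1 / ((n : ℝ) + 1)) * s) atTop (𝓝 (σ * 0 * s)) :=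
      (tendsto_one_div_add_atTop_nhds_zero_nat.const_mul σ).mul_const s
    have h2 : Continuous (fun x : ℝ => ψ s / (1 + Complex.I * (x : ℂ)) ^ 2) := by
      refine continuous_const.div (by fun_prop) fun x => ?_
      rw [← norm_pos_iff, norm_one_add_I_mul_sq]
      positivity
    have h3 := (h2.tendsto _).comp h1
    simp only [mul_zero, zero_mul, Complex.ofReal_zero, add_zero, one_pow, div_one] at h3
    exact h3
  have hp := fourier_toLp_ae_eq_zero_of_approx hψ (hfi 1 (by norm_num)) (hfb 1) (hlim 1)
    (measurableSet_Ioi (a := T)) fun n t ht => by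
      have := fourier_div_one_add_I_mul_sq_eq_zero hd hb (hε n) ht
      simpa only [hf, hhψ, one_mul] using this
  have hm := fourier_toLp_ae_eq_zero_of_approx hψ (hfi (-1) (by norm_num)) (hfb (-1)) (hlim (-1))
    (measurableSet_Iio (a := -T)) fun n t ht => by
      -- Replacing s by -s exchanges t with -t and reduces to the previous case.
      have := fourier_div_one_add_I_mul_sq_eq_zero (h := fun z => h (-z)) (C := C) (T := T)
        (t := -t) (hd.comp differentiable_neg) (fun z => by simpa using hb (-z)) (hε n)
        (lt_neg_of_lt_neg ht)
      rw [← this, ← Real.fourierInv_eq_fourier_neg, Real.fourierInv_eq_fourier_comp_neg]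
      refine congrFun (congrArg _ (funext fun s => ?_)) t
      simp only [hf]
      rw [← Complex.ofReal_neg, neg_neg, hhψ]
      congr 5
      ring
  filter_upwards [hp, hm] with t h1 h2 ht
  rcases lt_abs.1 ht with h | h
  · exact h1 h
  · exact h2 (lt_neg_of_lt_neg h)

/-! ### Transfer back to the Mellin setting -/

/-- The restriction of a member of the Mellin–Bernstein space to the positive half line belongs to
the Mellin Paley–Wiener space. -/
theorem mellinPaleyWiener_of_mellinBernstein {c T : ℝ} {φ : ℝ → ℂ} (hφ : φ ∈ MellinX 2 c)
    {f : ℝ × ℝ → ℂ} (hf : f ∈ MellinBernstein 2 c T) (hfφ : ∀ r : ℝ, 0 < r → f (r, 0) = φ r) :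
    φ ∈ MellinPaleyWiener c T := by
  obtain ⟨hpa, -, C, -, hC⟩ := hf
  have hpi := Real.pi_pos
  set F : ℂ → ℂ := fun w => f (Real.exp w.re, w.im) with hF
  have hFd : Differentiable ℂ F := hpa.differentiable
  refine ⟨hφ, ?_, _, isMellinTransformL2_fourier hφ, ?_⟩
  · have h1 : ContinuousOn (fun r : ℝ => F (Real.log r : ℝ)) (Set.Ioi 0) :=
      (hFd.continuous.comp Complex.continuous_ofReal).comp_continuousOn
        (Real.continuousOn_log.mono fun r hr => ne_of_gt hr)
    refine h1.congr fun r hr => ?_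
    simp only [hF, Complex.ofReal_re, Complex.ofReal_im]
    rw [Real.exp_log hr, hfφ r hr]
  -- The chosen h continues `mellinPullback c φ` through w = -2πz; its factor e^{-2πcz} cancels the
  -- growth r^{-c}.
  · refine fourier_toLp_ae_eq_zero_of_exp_type (C := 2 * Real.pi * C)
      (h := fun z => 2 * Real.pi * Complex.exp (-2 * Real.pi * c * z) * F (-2 * Real.pi * z))
      ?_ (fun z => ?_) _ (fun s => ?_)
    · exact (by fun_prop : Differentiable ℂ fun z : ℂ =>
        2 * (Real.pi : ℂ) * Complex.exp (-2 * Real.pi * c * z)).mul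
          (hFd.comp (by fun_prop : Differentiable ℂ fun z : ℂ => -2 * (Real.pi : ℂ) * z))
    · have e1 : ∀ a : ℝ, ((a : ℂ) * z).re = a * z.re := fun a => Complex.re_ofReal_mul _ _
      have e2 : ∀ a : ℝ, ((a : ℂ) * z).im = a * z.im := fun a => Complex.im_ofReal_mul _ _
      have e3 : (-2 * Real.pi : ℂ) = ((-2 * Real.pi : ℝ) : ℂ) := by push_cast; ring
      have e4 : (-2 * Real.pi * c : ℂ) = ((-2 * Real.pi * c : ℝ) : ℂ) := by push_cast; ring
      have h1 := hC (Real.exp (-2 * Real.pi * z.re)) (-2 * Real.pi * z.im) (Real.exp_pos _)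
      rw [← Real.exp_mul] at h1
      have h2 : T * |-2 * Real.pi * z.im| = 2 * Real.pi * T * |z.im| := by
        rw [abs_mul, abs_mul, abs_neg, abs_of_pos hpi, Nat.abs_ofNat]; ring
      rw [h2] at h1
      rw [norm_mul, norm_mul, Complex.norm_exp, e4, e3, e1]
      simp only [hF]
      rw [e1, e2]
      have h3 : ‖(2 * Real.pi : ℂ)‖ = 2 * Real.pi := by simp [abs_of_pos hpi]
      rw [h3]
      calc _ ≤ 2 * Real.pi * Real.exp (-2 * Real.pi * c * z.re) *
            (C * Real.exp (-2 * Real.pi * z.re * -c) * Real.exp (2 * Real.pi * T * |z.im|)) := by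
            gcongr
        _ = 2 * Real.pi * C * (Real.exp (-2 * Real.pi * c * z.re) *
            Real.exp (-2 * Real.pi * z.re * -c)) * Real.exp (2 * Real.pi * T * |z.im|) := by ring
        _ = _ := by
            rw [← Real.exp_add]
            ring_nf
            simp
    · have e3 : (-2 * Real.pi * s : ℂ) = ((-2 * Real.pi * s : ℝ) : ℂ) := by push_cast; ring
      simp only [hF]
      rw [e3, Complex.ofReal_re, Complex.ofReal_im, hfφ _ (Real.exp_pos _), mellinPullback]
      push_cast
      ring

theorem theorem4 (c T : ℝ) (hT : 0 < T) (φ : ℝ → ℂ) (hφ : φ ∈ MellinX 2 c) :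
    φ ∈ MellinPaleyWiener c T ↔
      ∃ f ∈ MellinBernstein 2 c T, ∀ r : ℝ, 0 < r → f (r, 0) = φ r :=
  ⟨exists_mellinBernstein_of_mellinPaleyWiener,
    fun ⟨_, hf, hfφ⟩ => mellinPaleyWiener_of_mellinBernstein hφ hf hfφ⟩
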